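/- Let $I,J,R$ be integers with $I>J\ge 2$ and $\min(I,2J)>R>J$. A real $I\times J\times 2$ array has rank $1$ if it is the outer product $\mathbf a\circ\mathbf b\circ\mathbf c=(a_ib_jc_k)_{i,j,k}$ of three nonzero real vectors, and the rank of an array $\mathcal Y$ is the smallest number of rank-$1$ arrays whose sum equals $\mathcal Y$. A best rank-$R$ approximation of $\mathcal Z\in\mathbb R^{I\times J\times 2}$ is an array $\mathcal X$ with $\operatorname{rank}(\mathcal X)\le R$ that minimizes $\|\mathcal Z-\mathcal Y\|_F^2$ over all $\mathcal Y\in\mathbb R^{I\times J\times 2}$ with $\operatorname{rank}(\mathcal Y)\le R$, where $\|\cdot\|_F$ is the Frobenius norm (the square root of the sum of the squared entries). Then almost every $\mathcal Z\in\mathbb R^{I\times J\times 2}$, with respect to $2IJ$-dimensional Lebesgue measure, has a best rank-$R$ approximation. -/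

import Mathlib

open MeasureTheory

/-- Real three-way arrays of size `I × J × K`. As an iterated function space this carries the
`I * J * K`-dimensional Lebesgue measure as its `volume`. -/
abbrev ThreeWayArray (I J K : ℕ) : Type := Fin I → Fin J → Fin K → ℝ

namespace ThreeWayArray

/-- The outer vector product `a ∘ b ∘ c`, with entries `a i * b j * c k`. -/
def outer {I J K : ℕ} (a : Fin I → ℝ) (b : Fin J → ℝ) (c : Fin K → ℝ) : ThreeWayArray I J K :=
  fun i j k => a i * b j * c k

/-- An array has rank 1 if it is the outer product of three nonzero vectors. -/
def IsRankOne {I J K : ℕ} (Y : ThreeWayArray I J K) : Prop :=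
  ∃ (a : Fin I → ℝ) (b : Fin J → ℝ) (c : Fin K → ℝ),
    a ≠ 0 ∧ b ≠ 0 ∧ c ≠ 0 ∧ Y = outer a b c

/-- `Y` is the sum of exactly `n` rank-1 arrays. -/
def IsSumOfRankOnes {I J K : ℕ} (n : ℕ) (Y : ThreeWayArray I J K) : Prop :=
  ∃ T : Fin n → ThreeWayArray I J K, (∀ r, IsRankOne (T r)) ∧ Y = ∑ r, T r

/-- The rank of `Y`: the smallest number of rank-1 arrays whose sum equals `Y`
(see `exists_isSumOfRankOnes`: such a number always exists). -/
noncomputable def rank {I J K : ℕ} (Y : ThreeWayArray I J K) : ℕ :=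
  sInf {n : ℕ | IsSumOfRankOnes n Y}

/-- The set `S_R(I,J,K)` of arrays of rank at most `R`. -/
def rankAtMost (I J K R : ℕ) : Set (ThreeWayArray I J K) :=
  {Y | rank Y ≤ R}

/-- The Frobenius norm: the square root of the sum of squares of the entries. -/
noncomputable def frobeniusNorm {I J K : ℕ} (Y : ThreeWayArray I J K) : ℝ :=
  Real.sqrt (∑ i, ∑ j, ∑ k, Y i j k ^ 2)

/-- `X` is a best rank-`R` approximation of `Z`: an optimal solution of the problem of minimizing
`‖Z - Y‖_F ^ 2` over the arrays `Y` of rank at most `R`. -/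
def IsBestRankApprox {I J K : ℕ} (R : ℕ) (Z X : ThreeWayArray I J K) : Prop :=
  X ∈ rankAtMost I J K R ∧
    ∀ Y ∈ rankAtMost I J K R, frobeniusNorm (Z - X) ^ 2 ≤ frobeniusNorm (Z - Y) ^ 2

/-- Every array is a finite sum of rank-1 arrays. -/
theorem exists_isSumOfRankOnes {I J K : ℕ} (Y : ThreeWayArray I J K) :
    ∃ n, IsSumOfRankOnes n Y := by
  classical
  let s : Finset (Fin I × Fin J × Fin K) := Finset.univ.filter fun p => Y p.1 p.2.1 p.2.2 ≠ 0
  let t : Fin I × Fin J × Fin K → ThreeWayArray I J K := fun p =>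
    outer (Pi.single p.1 (Y p.1 p.2.1 p.2.2)) (Pi.single p.2.1 1) (Pi.single p.2.2 1)
  refine ⟨s.card, fun r => t (s.equivFin.symm r).1, fun r => ?_, ?_⟩
  · have h := (Finset.mem_filter.1 (s.equivFin.symm r).2).2
    refine ⟨_, _, _, ?_, ?_, ?_, rfl⟩
    · simpa [Pi.single_eq_zero_iff] using h
    · simp [Pi.single_eq_zero_iff]
    · simp [Pi.single_eq_zero_iff]
  · rw [Equiv.sum_comp s.equivFin.symm (fun q : s => t q.1), Finset.sum_coe_sort s t]
    have h0 : ∀ p, p ∉ s → t p = 0 := by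
      intro p hp
      have h : Y p.1 p.2.1 p.2.2 = 0 := by simpa [s] using hp
      funext i j k
      simp [t, outer, h]
    rw [Finset.sum_subset (Finset.subset_univ s) (fun p _ hp => h0 p hp)]
    funext i j k
    simp only [Finset.sum_apply, t, outer]
    rw [Finset.sum_eq_single (i, j, k)]
    · simp
    · rintro ⟨i', j', k'⟩ _ h
      by_cases hi : i = i'
      · by_cases hj : j = j'
        · by_cases hk : k = k'
          · exact absurd (by rw [hi, hj, hk]) h
          · simp [Pi.single_apply, hk]
        · simp [Pi.single_apply, hj]
      · simp [Pi.single_apply, hi]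
    · simp

end ThreeWayArray

/-!
Viewing the horizontal slices of `Z` as vectors of the Euclidean space of `J × 2` matrices, a best
rank-`R` approximation is obtained by projecting them onto a best fitting `R`-dimensional subspace
`W`, provided that `W` is spanned by `R` matrices of rank one. For `J < R ≤ 2 J` a generic
`R`-dimensional subspace is: if `B` is a basis of it, then each pencil `B₁ - t B₀` of `R × J`
matrices has a left null vector, which yields a rank-one matrix `b ⊗ (1, t)` in `W`, and `R` values
of `t` suffice unless a determinant depending polynomially on `B` vanishes.

How `W` depends on `Z` is never analysed. Instead, both are rotated by a random product of
reflections in hyperplanes, under which best fits go to best fits and a fixed `W` becomes generic,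
so for each `Z` almost every rotation of `Z` has a best approximation. By Fubini's theorem there is
one rotation that does so for almost every `Z`, and rotations preserve null sets. The set of arrays
with a best approximation is measurable because it is σ-compact.
-/

section AnalyticZeroSet

open scoped ContDiff

variable {F : Type*} [NormedAddCommGroup F] [NormedSpace ℝ F]

theorem ae_ne_zero_of_contDiff_omega_real {f : ℝ → F} (hf : ContDiff ℝ ω f) {t₀ : ℝ}
    (h₀ : f t₀ ≠ 0) : ∀ᵐ t, f t ≠ 0 := by
  have hdisc : f ⁻¹' {0}ᶜ ∈ Filter.codiscreteWithin Set.univ :=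
    (contDiff_omega_iff_analyticOnNhd.1 hf).preimage_zero_mem_codiscrete h₀
  have hae := ae_restrict_le_codiscreteWithin (μ := volume) MeasurableSet.univ hdisc
  rw [Measure.restrict_univ] at hae
  exact hae

-- Almost every line through `v₀` meets the zero set in a null set, so by Fubini some
-- homothetic copy of the zero set about `v₀` is null, and hence so is the zero set itself.
theorem ae_ne_zero_of_contDiff_omega {V : Type*} [NormedAddCommGroup V] [NormedSpace ℝ V]
    [FiniteDimensional ℝ V] [MeasurableSpace V] [BorelSpace V] (μ : Measure V)
    [μ.IsAddHaarMeasure] {f : V → F} (hf : ContDiff ℝ ω f) {v₀ : V} (h₀ : f v₀ ≠ 0) :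
    ∀ᵐ v ∂μ, f v ≠ 0 := by
  have hline (u : V) : ∀ᵐ t : ℝ, f (v₀ + t • u) ≠ 0 :=
    ae_ne_zero_of_contDiff_omega_real (f := fun t : ℝ => f (v₀ + t • u)) (t₀ := 0) (by fun_prop)
      (by simpa using h₀)
  have hmeas : MeasurableSet {p : ℝ × V | f (v₀ + p.1 • p.2) ≠ 0} :=
    (isOpen_ne_fun (hf.continuous.comp (by fun_prop)) continuous_const).measurableSet
  have hswap : ∀ᵐ t : ℝ, ∀ᵐ u ∂μ, f (v₀ + t • u) ≠ 0 :=
    (Measure.ae_ae_comm hmeas).2 (.of_forall hline)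
  obtain ⟨t, ht, ht₀⟩ := (hswap.and (Measure.ae_ne volume 0)).exists
  have hhomothety : Measure.QuasiMeasurePreserving (fun w : V => t⁻¹ • (w - v₀)) μ μ :=
    (Measure.quasiMeasurePreserving_smul μ (inv_ne_zero ht₀)).comp
      (measurePreserving_sub_right μ v₀).quasiMeasurePreserving
  filter_upwards [hhomothety.ae ht] with w hw
  simpa [smul_smul, mul_inv_cancel₀ ht₀] using hw

end AnalyticZeroSet

theorem isSigmaCompact_setOf_exists_forall_le {X α : Type*} [TopologicalSpace X]
    [SigmaCompactSpace X] [TopologicalSpace α] [Preorder α] [OrderClosedTopology α]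
    {d : X → X → α} (hd : Continuous fun p : X × X => d p.1 p.2) {C : Set X}
    (hC : IsSigmaCompact C) : IsSigmaCompact {z | ∃ x ∈ C, ∀ y ∈ C, d z x ≤ d z y} := by
  obtain ⟨s, hs, rfl⟩ := hC
  have hclosed : IsClosed {p : X × X | ∀ y ∈ ⋃ n, s n, d p.1 p.2 ≤ d p.1 y} := by
    simp only [Set.ofPred_forall]
    exact isClosed_biInter fun y _ =>
      isClosed_le hd (hd.comp (continuous_fst.prodMk continuous_const))
  have hprod : IsSigmaCompact (⋃ n, ⋃ m, compactCovering X m ×ˢ s n) :=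
    isSigmaCompact_iUnion _ fun n => isSigmaCompact_iUnion_of_isCompact _ fun m =>
      (isCompact_compactCovering X m).prod (hs n)
  obtain ⟨t, ht, htU⟩ := hprod
  have hinter : IsSigmaCompact
      (⋃ n, t n ∩ {p : X × X | ∀ y ∈ ⋃ n, s n, d p.1 p.2 ≤ d p.1 y}) :=
    isSigmaCompact_iUnion_of_isCompact _ fun n => (ht n).inter_right hclosed
  convert hinter.image continuous_fst using 1
  ext z
  simp [← Set.iUnion_inter, htU, ← Set.iUnion_prod_const, ← Set.prod_iUnion, iUnion_compactCovering]

section Reflections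

open Module

variable {E : Type*} [NormedAddCommGroup E] [InnerProductSpace ℝ E]

/-- The composition of the reflections in the hyperplanes orthogonal to `v 0, …, v (n - 1)`. A zero
entry of `v` contributes the identity. -/
noncomputable def reflectionProd {n : ℕ} (v : Fin n → E) : E ≃ₗᵢ[ℝ] E :=
  (List.ofFn fun i => (ℝ ∙ v i)ᗮ.reflection).prod

theorem reflectionProd_succ_apply {n : ℕ} (v : Fin (n + 1) → E) (x : E) :
    reflectionProd v x = (ℝ ∙ v 0)ᗮ.reflection (reflectionProd (Fin.tail v) x) := by
  simp only [reflectionProd, List.ofFn_succ, List.prod_cons, LinearIsometryEquiv.coe_mul,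
    Function.comp_apply, Fin.tail]

theorem reflection_orthogonal_span_singleton_apply (v x : E) :
    (ℝ ∙ v)ᗮ.reflection x = x - (2 * inner ℝ v x / ‖v‖ ^ 2) • v := by
  rw [Submodule.reflection_orthogonal_apply, Submodule.reflection_singleton_apply]
  simp only [RCLike.ofReal_real_eq_id, id_eq]
  module

theorem norm_sq_smul_reflection_orthogonal_span_singleton (v x : E) :
    ‖v‖ ^ 2 • (ℝ ∙ v)ᗮ.reflection x = ‖v‖ ^ 2 • x - (2 * inner ℝ v x) • v := by
  rcases eq_or_ne v 0 with rfl | hv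
  · simp
  · rw [reflection_orthogonal_span_singleton_apply, smul_sub, smul_smul,
      mul_div_cancel₀ _ (pow_ne_zero 2 (norm_ne_zero_iff.2 hv))]

theorem contDiff_prod_norm_sq_smul_reflectionProd {n : ℕ} {k : WithTop ℕ∞} :
    ContDiff ℝ k fun p : (Fin n → E) × E => (∏ i, ‖p.1 i‖ ^ 2) • reflectionProd p.1 p.2 := by
  induction n with
  | zero => simpa [reflectionProd] using contDiff_snd
  | succ n ih =>
    have htail : ContDiff ℝ k fun p : (Fin (n + 1) → E) × E =>
        (∏ i, ‖Fin.tail p.1 i‖ ^ 2) • reflectionProd (Fin.tail p.1) p.2 :=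
      ih.comp (f := fun p : (Fin (n + 1) → E) × E => (Fin.tail p.1, p.2))
        (by unfold Fin.tail; fun_prop)
    have hhead : ContDiff ℝ k fun p : (Fin (n + 1) → E) × E => p.1 0 := by fun_prop
    have hstep (p : (Fin (n + 1) → E) × E) : (∏ i, ‖p.1 i‖ ^ 2) • reflectionProd p.1 p.2 =
        ‖p.1 0‖ ^ 2 • (∏ i, ‖Fin.tail p.1 i‖ ^ 2) • reflectionProd (Fin.tail p.1) p.2 -
          (2 * inner ℝ (p.1 0) ((∏ i, ‖Fin.tail p.1 i‖ ^ 2) •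
            reflectionProd (Fin.tail p.1) p.2)) • p.1 0 := by
      rw [← norm_sq_smul_reflection_orthogonal_span_singleton, map_smul, smul_smul,
        Fin.prod_univ_succ, reflectionProd_succ_apply]
      rfl
    simp only [hstep]
    exact ((hhead.norm_sq ℝ).smul htail).sub
      ((contDiff_const.mul (hhead.inner ℝ htail)).smul hhead)

theorem measurable_reflectionProd [MeasurableSpace E] [BorelSpace E] [SecondCountableTopology E]
    {α : Type*} [MeasurableSpace α] {n : ℕ} {v : α → Fin n → E} {x : α → E} (hv : Measurable v)
    (hx : Measurable x) : Measurable fun a => reflectionProd (v a) (x a) := by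
  induction n with
  | zero => simpa [reflectionProd] using hx
  | succ n ih =>
    simp only [reflectionProd_succ_apply, reflection_orthogonal_span_singleton_apply]
    have hentry (i : Fin (n + 1)) : Measurable fun a => v a i := (measurable_pi_apply i).comp hv
    have htail : Measurable fun a => reflectionProd (Fin.tail (v a)) (x a) :=
      ih (measurable_pi_lambda _ fun i => hentry i.succ)
    exact htail.sub ((((hentry 0).inner htail).const_mul 2).div
      ((hentry 0).norm.pow_const 2) |>.smul (hentry 0))

theorem exists_linearIsometryEquiv_map_eq {𝕜 V : Type*} [RCLike 𝕜] [NormedAddCommGroup V]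
    [InnerProductSpace 𝕜 V] [FiniteDimensional 𝕜 V] {W W₀ : Submodule 𝕜 V}
    (h : finrank 𝕜 W = finrank 𝕜 W₀) :
    ∃ φ : V ≃ₗᵢ[𝕜] V, W.map φ.toLinearEquiv.toLinearMap = W₀ := by
  let e : W ≃ₗᵢ[𝕜] W₀ :=
    (stdOrthonormalBasis 𝕜 W).equiv (stdOrthonormalBasis 𝕜 W₀) (finCongr h)
  let L : W →ₗᵢ[𝕜] V := W₀.subtypeₗᵢ.comp e.toLinearIsometry
  let φ : V ≃ₗᵢ[𝕜] V := L.extend.toLinearIsometryEquiv rfl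
  have hφ : W.map φ.toLinearEquiv.toLinearMap ≤ W₀ := by
    rintro _ ⟨x, hx, rfl⟩
    have hext : φ x = e ⟨x, hx⟩ := L.extend_apply ⟨x, hx⟩
    exact hext ▸ (e ⟨x, hx⟩).2
  exact ⟨φ, Submodule.eq_of_le_of_finrank_eq hφ
    ((LinearEquiv.finrank_map_eq φ.toLinearEquiv W).trans h)⟩

theorem exists_reflectionProd_eq_prod (l : List E) : ∃ n ≤ l.length, ∃ v : Fin n → E,
    (∀ i, v i ≠ 0) ∧ reflectionProd v = (l.map fun u => (ℝ ∙ u)ᗮ.reflection).prod := by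
  induction l with
  | nil => exact ⟨0, le_rfl, Fin.elim0, fun i => i.elim0, rfl⟩
  | cons u l ih =>
    obtain ⟨n, hn, v, hv, hvl⟩ := ih
    rw [List.map_cons, List.prod_cons, ← hvl]
    rcases eq_or_ne u 0 with rfl | hu
    · refine ⟨n, hn.trans (Nat.le_succ _), v, hv, ?_⟩
      ext x
      rw [LinearIsometryEquiv.coe_mul, Function.comp_apply,
        reflection_orthogonal_span_singleton_apply, smul_zero, sub_zero]
    · refine ⟨n + 1, Nat.succ_le_succ hn, Fin.cons u v, Fin.cases hu hv, ?_⟩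
      ext x
      exact reflectionProd_succ_apply _ x

theorem map_reflection_orthogonal_span_singleton {W : Submodule ℝ E} {w : E} (hw : w ∈ W) :
    W.map (ℝ ∙ w)ᗮ.reflection.toLinearEquiv.toLinearMap = W := by
  have hmem {x : E} (hx : x ∈ W) : (ℝ ∙ w)ᗮ.reflection x ∈ W := by
    rw [reflection_orthogonal_span_singleton_apply]
    exact W.sub_mem hx (W.smul_mem _ hw)
  refine le_antisymm (Submodule.map_le_iff_le_comap.2 fun x hx => hmem hx) fun x hx => ?_
  exact ⟨_, hmem hx, Submodule.reflection_reflection _ x⟩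

theorem exists_map_reflectionProd_eq_of_le {W : Submodule ℝ E} (hW : W ≠ ⊥) {m n : ℕ}
    (hmn : m ≤ n) {v : Fin m → E} (hv : ∀ i, v i ≠ 0) : ∃ u : Fin n → E, (∀ i, u i ≠ 0) ∧
      W.map (reflectionProd u).toLinearEquiv.toLinearMap =
        W.map (reflectionProd v).toLinearEquiv.toLinearMap := by
  induction n, hmn using Nat.le_induction with
  | base => exact ⟨v, hv, rfl⟩
  | succ n _ ih =>
    obtain ⟨u, hu, huv⟩ := ih
    obtain ⟨w, hw, hw₀⟩ := W.exists_mem_ne_zero_of_ne_bot hW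
    refine ⟨Fin.cons (reflectionProd u w) u, Fin.cases (by simpa using hw₀) hu, ?_⟩
    have hcomp : (reflectionProd (Fin.cons (reflectionProd u w) u)).toLinearEquiv.toLinearMap =
        (ℝ ∙ reflectionProd u w)ᗮ.reflection.toLinearEquiv.toLinearMap ∘ₗ
          (reflectionProd u).toLinearEquiv.toLinearMap :=
      LinearMap.ext (reflectionProd_succ_apply _)
    rw [hcomp, Submodule.map_comp, ← huv]
    exact map_reflection_orthogonal_span_singleton (Submodule.mem_map_of_mem hw)

theorem exists_map_reflectionProd_eq [FiniteDimensional ℝ E] {W W₀ : Submodule ℝ E}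
    (h : finrank ℝ W = finrank ℝ W₀) (hW : W ≠ ⊥) : ∃ v : Fin (finrank ℝ E) → E,
      (∀ i, v i ≠ 0) ∧ W.map (reflectionProd v).toLinearEquiv.toLinearMap = W₀ := by
  obtain ⟨φ, rfl⟩ := exists_linearIsometryEquiv_map_eq h
  obtain ⟨l, hl, rfl⟩ := φ.reflections_generate_dim
  obtain ⟨n, hn, v, hv, hvl⟩ := exists_reflectionProd_eq_prod l
  rw [← hvl]
  exact exists_map_reflectionProd_eq_of_le hW (hn.trans hl) hv

end Reflections

section GenericRotation

open Module
open scoped ContDiff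

theorem exists_span_range_eq_of_map_eq_span {𝕜 V V' ι : Type*} [DivisionRing 𝕜] [AddCommGroup V]
    [Module 𝕜 V] [AddCommGroup V'] [Module 𝕜 V'] [Fintype ι] {L : V →ₗ[𝕜] V'}
    {W : Submodule 𝕜 V} [FiniteDimensional 𝕜 W] {x : ι → V'} (hx : LinearIndependent 𝕜 x)
    (hmap : W.map L = Submodule.span 𝕜 (Set.range x)) (hW : finrank 𝕜 W = Fintype.card ι) :
    ∃ β : ι → V, Submodule.span 𝕜 (Set.range β) = W ∧ L ∘ β = x := by
  have hmem (i : ι) : x i ∈ W.map L := hmap ▸ Submodule.subset_span ⟨i, rfl⟩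
  choose β hβW hβ using hmem
  have hβx : L ∘ β = x := funext hβ
  have hβli : LinearIndependent 𝕜 β := .of_comp L (hβx ▸ hx)
  refine ⟨β, Submodule.eq_of_le_of_finrank_eq (Submodule.span_le.2 ?_) ?_, hβx⟩
  · exact Set.range_subset_iff.2 hβW
  · rw [hW, finrank_span_eq_card hβli]

theorem ae_exists_span_range_eq_map_reflectionProd {E F : Type*} [NormedAddCommGroup E]
    [InnerProductSpace ℝ E] [FiniteDimensional ℝ E] [MeasurableSpace E] [BorelSpace E]
    [NormedAddCommGroup F] [NormedSpace ℝ F] {n : ℕ} (hn : n ≠ 0) {f : (Fin n → E) → F}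
    (hf : ContDiff ℝ ω f) {x : Fin n → E} (hx : LinearIndependent ℝ x) (hfx : f x ≠ 0)
    {W : Submodule ℝ E} (hW : finrank ℝ W = n) :
    ∀ᵐ v : Fin (finrank ℝ E) → E, ∃ y : Fin n → E, f y ≠ 0 ∧
      Submodule.span ℝ (Set.range y) = W.map (reflectionProd v).toLinearEquiv.toLinearMap := by
  have hspan := (finrank_span_eq_card hx).trans (Fintype.card_fin n)
  have hbot : W ≠ ⊥ := by
    rintro rfl
    exact hn (hW.symm.trans (finrank_bot ℝ E))
  obtain ⟨v₀, hv₀, hmap⟩ := exists_map_reflectionProd_eq (hW.trans hspan.symm) hbot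
  let p (v : Fin (finrank ℝ E) → E) : ℝ := ∏ i, ‖v i‖ ^ 2
  let L (v : Fin (finrank ℝ E) → E) : E →ₗ[ℝ] E :=
    p v • (reflectionProd v).toLinearEquiv.toLinearMap
  have hp₀ : p v₀ ≠ 0 :=
    Finset.prod_ne_zero_iff.2 fun i _ => pow_ne_zero 2 (norm_ne_zero_iff.2 (hv₀ i))
  obtain ⟨β, rfl, hβ⟩ := exists_span_range_eq_of_map_eq_span (L := L v₀) hx
    ((Submodule.map_smul _ _ _ hp₀).trans hmap) (hW.trans (Fintype.card_fin n).symm)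
  have hp : ContDiff ℝ ω p := contDiff_prod fun i _ => (contDiff_apply ℝ E i).norm_sq ℝ
  have hL : ContDiff ℝ ω fun v => L v ∘ β := contDiff_pi.2 fun r =>
    contDiff_prod_norm_sq_smul_reflectionProd.comp (contDiff_id.prodMk contDiff_const)
  have hne := ae_ne_zero_of_contDiff_omega volume (v₀ := v₀) (hp.smul (hf.comp hL))
    (smul_ne_zero hp₀ (by rwa [Function.comp_apply, hβ]))
  filter_upwards [hne] with v hv
  obtain ⟨hpv, hfv⟩ := smul_ne_zero_iff.1 hv
  refine ⟨L v ∘ β, hfv, ?_⟩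
  rw [Set.range_comp, ← Submodule.map_span, Submodule.map_smul _ _ _ hpv]

end GenericRotation

section SqDistSum

open Module Submodule

variable {𝕜 E ι : Type*} [RCLike 𝕜] [NormedAddCommGroup E] [InnerProductSpace 𝕜 E] [Fintype ι]

theorem isCompact_setOf_orthonormal [ProperSpace E] (n : ℕ) :
    IsCompact {q : Fin n → E | Orthonormal 𝕜 q} := by
  refine Metric.isCompact_of_isClosed_isBounded ?_ ?_
  · simp only [orthonormal_iff_ite, Set.ofPred_forall]
    exact isClosed_iInter fun i => isClosed_iInter fun j =>
      isClosed_eq (by fun_prop) continuous_const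
  · refine Metric.isBounded_closedBall (x := (0 : Fin n → E)) (r := 1) |>.subset fun q hq => ?_
    rw [mem_closedBall_zero_iff, pi_norm_le_iff_of_nonneg zero_le_one]
    exact fun i => (hq.1 i).le

theorem exists_orthonormal_le_span [FiniteDimensional 𝕜 E] {W : Submodule 𝕜 E} {n : ℕ}
    (hW : finrank 𝕜 W ≤ n) (hn : n ≤ finrank 𝕜 E) :
    ∃ q : Fin n → E, Orthonormal 𝕜 q ∧ W ≤ span 𝕜 (Set.range q) := by
  let e : Fin (finrank 𝕜 W) ↪ Fin (finrank 𝕜 E) := Fin.castLEEmb (hW.trans hn)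
  let w : Fin (finrank 𝕜 W) → E := W.subtype ∘ stdOrthonormalBasis 𝕜 W
  have hw : Orthonormal 𝕜 w :=
    (stdOrthonormalBasis 𝕜 W).orthonormal.comp_linearIsometry W.subtypeₗᵢ
  have hspan : span 𝕜 (Set.range w) = W := by
    rw [Set.range_comp, span_image, ← (stdOrthonormalBasis 𝕜 W).coe_toBasis,
      (stdOrthonormalBasis 𝕜 W).toBasis.span_eq, map_subtype_top]
  have hext : Orthonormal 𝕜 ((Set.range e).domRestrict (Function.extend e w 0)) := by
    convert hw.comp _ (Equiv.ofInjective e e.injective).symm.injective using 1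
    ext ⟨_, i, rfl⟩
    simp [e.injective.extend_apply]
  obtain ⟨b, hb⟩ := hext.exists_orthonormalBasis_extension_of_card_eq (by simp)
  refine ⟨b ∘ Fin.castLE hn, b.orthonormal.comp _ (Fin.castLE_injective hn), ?_⟩
  rw [← hspan]
  refine span_mono ?_
  rintro _ ⟨i, rfl⟩
  exact ⟨Fin.castLE hW i, (hb (e i) ⟨i, rfl⟩).trans (e.injective.extend_apply w 0 i)⟩

theorem starProjection_span_range_apply {κ : Type*} [Fintype κ] {q : κ → E}
    (hq : Orthonormal 𝕜 q) [(span 𝕜 (Set.range q)).HasOrthogonalProjection] (x : E) :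
    (span 𝕜 (Set.range q)).starProjection x = ∑ r, inner 𝕜 (q r) x • q r := by
  classical
  refine eq_starProjection_of_mem_of_inner_eq_zero
    (sum_mem fun r _ => smul_mem _ _ (subset_span ⟨r, rfl⟩)) fun w hw => ?_
  suffices h : span 𝕜 (Set.range q) ≤ (𝕜 ∙ (x - ∑ r, inner 𝕜 (q r) x • q r))ᗮ from
    mem_orthogonal_singleton_iff_inner_right.1 (h hw)
  rw [span_le]
  rintro _ ⟨r, rfl⟩
  rw [SetLike.mem_coe, mem_orthogonal_singleton_iff_inner_left, inner_sub_right,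
    hq.inner_right_fintype, sub_self]

/-- The sum of the squared distances of the vectors `z i` to the subspace `W`. -/
noncomputable def sqDistSum (z : ι → E) (W : Submodule 𝕜 E) [W.HasOrthogonalProjection] : ℝ :=
  ∑ i, ‖z i - W.starProjection (z i)‖ ^ 2

theorem sqDistSum_le {z y : ι → E} {W : Submodule 𝕜 E} [W.HasOrthogonalProjection]
    (hy : ∀ i, y i ∈ W) : sqDistSum z W ≤ ∑ i, ‖z i - y i‖ ^ 2 := by
  refine Finset.sum_le_sum fun i _ => ?_
  gcongr
  rw [starProjection_minimal]
  exact ciInf_le ⟨0, by rintro _ ⟨w, rfl⟩; positivity⟩ (⟨y i, hy i⟩ : W)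

theorem sqDistSum_anti (z : ι → E) {W W' : Submodule 𝕜 E} [W.HasOrthogonalProjection]
    [W'.HasOrthogonalProjection] (h : W ≤ W') : sqDistSum z W' ≤ sqDistSum z W :=
  sqDistSum_le fun i => h (starProjection_apply_mem W (z i))

theorem sqDistSum_map (φ : E ≃ₗᵢ[𝕜] E) (z : ι → E) (W : Submodule 𝕜 E)
    [W.HasOrthogonalProjection] [(W.map φ.toLinearEquiv.toLinearMap).HasOrthogonalProjection] :
    sqDistSum (φ ∘ z) (W.map φ.toLinearEquiv.toLinearMap) = sqDistSum z W := by
  refine Finset.sum_congr rfl fun i _ => ?_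
  rw [Function.comp_apply, starProjection_map_apply, φ.symm_apply_apply, ← map_sub, φ.norm_map]

theorem exists_sqDistSum_le [FiniteDimensional 𝕜 E] (z : ι → E) {n : ℕ} (hn : n ≤ finrank 𝕜 E) :
    ∃ W : Submodule 𝕜 E, finrank 𝕜 W = n ∧
      ∀ W' : Submodule 𝕜 E, finrank 𝕜 W' ≤ n → sqDistSum z W ≤ sqDistSum z W' := by
  let cost (q : Fin n → E) : ℝ := ∑ i, ‖z i - ∑ r, inner 𝕜 (q r) (z i) • q r‖ ^ 2
  have hcost {q : Fin n → E} (hq : Orthonormal 𝕜 q) :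
      sqDistSum z (span 𝕜 (Set.range q)) = cost q := by
    simp only [sqDistSum, starProjection_span_range_apply hq, cost]
  have : ProperSpace E := FiniteDimensional.proper_rclike 𝕜 E
  obtain ⟨q₀, hq₀, -⟩ := exists_orthonormal_le_span (W := (⊥ : Submodule 𝕜 E)) (by simp) hn
  obtain ⟨q, hq, hmin⟩ := (isCompact_setOf_orthonormal (𝕜 := 𝕜) (E := E) n).exists_isMinOn
    ⟨q₀, hq₀⟩ (f := cost) (by fun_prop : Continuous cost).continuousOn
  refine ⟨span 𝕜 (Set.range q), by simpa using finrank_span_eq_card hq.linearIndependent,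
    fun W' hW' => ?_⟩
  obtain ⟨q', hq', hle⟩ := exists_orthonormal_le_span hW' hn
  calc sqDistSum z (span 𝕜 (Set.range q))
      = cost q := hcost hq
    _ ≤ cost q' := hmin hq'
    _ = sqDistSum z (span 𝕜 (Set.range q')) := (hcost hq').symm
    _ ≤ sqDistSum z W' := sqDistSum_anti z hle

end SqDistSum

section LeftKernel

open Matrix

variable {m n : Type*} [Fintype m] [Fintype n] [DecidableEq n]

section CommRing

variable {S : Type*} [CommRing S]

/-- The orthogonal projection of `w` to the left kernel of `M`, multiplied by `det (Mᵀ M)` to make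
it polynomial in the entries of `M`. -/
def leftKernelVec (M : Matrix m n S) (w : m → S) : m → S :=
  (Mᵀ * M).det • w - M *ᵥ ((Mᵀ * M).adjugate *ᵥ (Mᵀ *ᵥ w))

theorem leftKernelVec_vecMul (M : Matrix m n S) (w : m → S) : leftKernelVec M w ᵥ* M = 0 := by
  rw [← mulVec_transpose, leftKernelVec, mulVec_sub, mulVec_smul, mulVec_mulVec, mulVec_mulVec,
    mul_adjugate, smul_mulVec, one_mulVec, sub_self]

theorem leftKernelVec_of_vecMul_eq_zero {M : Matrix m n S} {w : m → S} (h : w ᵥ* M = 0) :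
    leftKernelVec M w = (Mᵀ * M).det • w := by
  rw [leftKernelVec, mulVec_transpose, h, mulVec_zero, mulVec_zero, sub_zero]

end CommRing

theorem det_transpose_mul_self_ne_zero {𝕜 : Type*} [Field 𝕜] [LinearOrder 𝕜]
    [IsStrictOrderedRing 𝕜] {M : Matrix m n 𝕜} (h : Function.Injective M.mulVec) :
    (Mᵀ * M).det ≠ 0 := by
  intro hdet
  obtain ⟨x, hx₀, hx⟩ := exists_mulVec_eq_zero_iff.2 hdet
  have hker : x ∈ (Mᵀ * M).mulVecLin.ker := hx
  rw [ker_mulVecLin_transpose_mul_self] at hker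
  exact hx₀ (h (hker.trans (mulVec_zero M).symm))

variable {𝕜 V : Type*} [NontriviallyNormedField 𝕜] [NormedAddCommGroup V] [NormedSpace 𝕜 V]
  {k : WithTop ℕ∞}

theorem contDiff_det {A : V → Matrix n n 𝕜} (hA : ∀ i j, ContDiff 𝕜 k fun v => A v i j) :
    ContDiff 𝕜 k fun v => (A v).det := by
  simp only [det_apply']
  exact ContDiff.sum fun σ _ => contDiff_const.mul (contDiff_prod fun i _ => hA _ _)

theorem contDiff_adjugate_apply {A : V → Matrix n n 𝕜} (hA : ∀ i j, ContDiff 𝕜 k fun v => A v i j)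
    (i j : n) : ContDiff 𝕜 k fun v => (A v).adjugate i j := by
  simp only [adjugate_apply]
  refine contDiff_det fun a b => ?_
  rcases eq_or_ne a j with rfl | h
  · simpa only [updateRow_self] using contDiff_const
  · simpa only [updateRow_ne h] using hA a b

theorem contDiff_leftKernelVec_apply {A : V → Matrix m n 𝕜}
    (hA : ∀ i j, ContDiff 𝕜 k fun v => A v i j) (w : m → 𝕜) (i : m) :
    ContDiff 𝕜 k fun v => leftKernelVec (A v) w i := by
  have hgram (a b : n) : ContDiff 𝕜 k fun v => ((A v)ᵀ * A v) a b := by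
    simp only [mul_apply, transpose_apply]
    fun_prop
  have hadj := contDiff_adjugate_apply hgram
  have hdet := contDiff_det hgram
  simp only [leftKernelVec, Pi.sub_apply, Pi.smul_apply, smul_eq_mul, mulVec, dotProduct,
    transpose_apply]
  fun_prop

end LeftKernel

namespace ThreeWayArray

variable {I J K R : ℕ}

theorem outer_eq_zero_of_not_isRankOne {a : Fin I → ℝ} {b : Fin J → ℝ} {c : Fin K → ℝ}
    (h : ¬ IsRankOne (outer a b c)) : outer a b c = 0 := by
  by_contra h₀
  refine h ⟨a, b, c, ?_, ?_, ?_, rfl⟩ <;> rintro rfl <;> exact h₀ (by funext i j k; simp [outer])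

theorem rank_sum_outer_le {ι : Type*} [Fintype ι] (a : ι → Fin I → ℝ) (b : ι → Fin J → ℝ)
    (c : ι → Fin K → ℝ) : rank (∑ r, outer (a r) (b r) (c r)) ≤ Fintype.card ι := by
  classical
  let s : Finset ι := Finset.univ.filter fun r => IsRankOne (outer (a r) (b r) (c r))
  have hs : IsSumOfRankOnes s.card (∑ r, outer (a r) (b r) (c r)) := by
    refine ⟨fun m => outer (a (s.equivFin.symm m)) (b (s.equivFin.symm m)) (c (s.equivFin.symm m)),
      fun m => (Finset.mem_filter.1 (s.equivFin.symm m).2).2, ?_⟩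
    rw [Equiv.sum_comp s.equivFin.symm (fun q : s => outer (a q) (b q) (c q)),
      Finset.sum_coe_sort s fun q => outer (a q) (b q) (c q)]
    refine (Finset.sum_subset (Finset.subset_univ s) fun r _ hr => ?_).symm
    exact outer_eq_zero_of_not_isRankOne fun h => hr (Finset.mem_filter.2 ⟨Finset.mem_univ _, h⟩)
  exact (Nat.sInf_le hs).trans (Finset.card_le_univ s)

theorem rankAtMost_eq_range (I J K R : ℕ) : rankAtMost I J K R = Set.range
    fun p : Fin R → (Fin I → ℝ) × (Fin J → ℝ) × (Fin K → ℝ) =>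
      ∑ r, outer (p r).1 (p r).2.1 (p r).2.2 := by
  ext Y
  constructor
  · intro (h : rank Y ≤ R)
    obtain ⟨T, hT, hY⟩ : IsSumOfRankOnes (rank Y) Y := Nat.sInf_mem (exists_isSumOfRankOnes Y)
    choose a b c _ _ _ habc using hT
    obtain ⟨d, rfl⟩ := Nat.exists_eq_add_of_le h
    have h₀ : outer (0 : Fin I → ℝ) (0 : Fin J → ℝ) (0 : Fin K → ℝ) = 0 := by
      funext i j k; simp [outer]
    refine ⟨Fin.append (fun r => (a r, b r, c r)) 0, ?_⟩
    simp only [Fin.sum_univ_add, Fin.append_left, Fin.append_right, Pi.zero_apply, Prod.fst_zero,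
      Prod.snd_zero, h₀, Finset.sum_const_zero, add_zero, ← habc, ← hY]
  · rintro ⟨p, rfl⟩
    exact (rank_sum_outer_le _ _ _).trans_eq (Fintype.card_fin R)

theorem rankAtMost_eq_univ (h : J * K ≤ R) : rankAtMost I J K R = Set.univ := by
  refine Set.eq_univ_of_forall fun Y => ?_
  have hY : ∑ p : Fin J × Fin K,
      outer (fun i => Y i p.1 p.2) (Pi.single p.1 1) (Pi.single p.2 1) = Y := by
    funext i j k
    simp [outer, Finset.sum_apply, Fintype.sum_prod_type, Pi.single_apply]
  have hrank := rank_sum_outer_le (fun (p : Fin J × Fin K) i => Y i p.1 p.2)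
    (fun p => Pi.single p.1 1) (fun p => Pi.single p.2 1)
  rw [hY, Fintype.card_prod, Fintype.card_fin, Fintype.card_fin] at hrank
  exact hrank.trans h

theorem isBestRankApprox_self {Z : ThreeWayArray I J K} (hZ : Z ∈ rankAtMost I J K R) :
    IsBestRankApprox R Z Z := by
  refine ⟨hZ, fun Y _ => ?_⟩
  have h₀ : frobeniusNorm (0 : ThreeWayArray I J K) = 0 := by simp [frobeniusNorm]
  rw [sub_self, h₀, zero_pow two_ne_zero]
  positivity

theorem isSigmaCompact_rankAtMost (I J K R : ℕ) : IsSigmaCompact (rankAtMost I J K R) := by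
  rw [rankAtMost_eq_range]
  refine isSigmaCompact_range ?_
  unfold outer
  fun_prop

theorem measurableSet_setOf_exists_isBestRankApprox (I J K R : ℕ) :
    MeasurableSet {Z : ThreeWayArray I J K | ∃ X, IsBestRankApprox R Z X} := by
  have hdist : Continuous fun p : ThreeWayArray I J K × ThreeWayArray I J K =>
      frobeniusNorm (p.1 - p.2) ^ 2 := by
    unfold frobeniusNorm
    fun_prop
  obtain ⟨C, hC, hU⟩ :=
    isSigmaCompact_setOf_exists_forall_le (d := fun Z X => frobeniusNorm (Z - X) ^ 2) hdist
      (isSigmaCompact_rankAtMost I J K R)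
  have hmeas : MeasurableSet (⋃ n, C n) := .iUnion fun n => (hC n).isClosed.measurableSet
  rwa [hU] at hmeas

/-- The Euclidean space in which the horizontal slices of an array live. -/
abbrev SliceSpace (J K : ℕ) : Type := EuclideanSpace ℝ (Fin J × Fin K)

/-- The identification of horizontal slices with vectors of the slice space, under which the
Frobenius norm of an array becomes a sum of squared norms. -/
def sliceEquiv (J K : ℕ) : (Fin J → Fin K → ℝ) ≃ₗ[ℝ] SliceSpace J K :=
  (LinearEquiv.curry ℝ ℝ (Fin J) (Fin K)).symm.trans (WithLp.linearEquiv 2 ℝ _).symm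

@[simp]
theorem sliceEquiv_apply (x : Fin J → Fin K → ℝ) (p : Fin J × Fin K) :
    sliceEquiv J K x p = x p.1 p.2 := rfl

theorem frobeniusNorm_sq (Y : ThreeWayArray I J K) :
    frobeniusNorm Y ^ 2 = ∑ i, ‖sliceEquiv J K (Y i)‖ ^ 2 := by
  rw [frobeniusNorm, Real.sq_sqrt (by positivity)]
  simp only [EuclideanSpace.norm_sq_eq, Fintype.sum_prod_type, sliceEquiv_apply,
    Real.norm_eq_abs, sq_abs]

/-- The vectors `b ⊗ c` of the slice space, that is, the `J × K` matrices of rank at most 1. -/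
def IsDecomposable (x : SliceSpace J K) : Prop :=
  ∃ (b : Fin J → ℝ) (c : Fin K → ℝ), ∀ j k, x (j, k) = b j * c k

/-- The subspace `W` lies in the span of `R` decomposable vectors: the rank of a subspace of
matrices. -/
def SpanRankLE (R : ℕ) (W : Submodule ℝ (SliceSpace J K)) : Prop :=
  ∃ x : Fin R → SliceSpace J K, (∀ r, IsDecomposable (x r)) ∧ W ≤ Submodule.span ℝ (Set.range x)

theorem SpanRankLE.mono {W W' : Submodule ℝ (SliceSpace J K)} (h : SpanRankLE R W)
    (hle : W' ≤ W) : SpanRankLE R W' :=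
  let ⟨x, hx, hW⟩ := h
  ⟨x, hx, hle.trans hW⟩

theorem SpanRankLE.finrank_le {W : Submodule ℝ (SliceSpace J K)} (h : SpanRankLE R W) :
    Module.finrank ℝ W ≤ R := by
  obtain ⟨x, -, hW⟩ := h
  exact (Submodule.finrank_mono hW).trans
    ((finrank_range_le_card (R := ℝ) x).trans_eq (Fintype.card_fin R))

theorem mem_rankAtMost_iff_spanRankLE {Y : ThreeWayArray I J K} : Y ∈ rankAtMost I J K R ↔
    SpanRankLE R (Submodule.span ℝ (Set.range fun i => sliceEquiv J K (Y i))) := by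
  rw [rankAtMost_eq_range, Set.mem_range]
  constructor
  · rintro ⟨p, rfl⟩
    refine ⟨fun r => sliceEquiv J K fun j k => (p r).2.1 j * (p r).2.2 k,
      fun r => ⟨_, _, fun j k => rfl⟩, Submodule.span_le.2 ?_⟩
    rintro _ ⟨i, rfl⟩
    refine (Submodule.mem_span_range_iff_exists_fun ℝ).2 ⟨fun r => (p r).1 i, ?_⟩
    ext q
    simp [outer, mul_assoc]
  · rintro ⟨x, hx, hspan⟩
    choose b c hbc using hx
    choose a ha using fun i => (Submodule.mem_span_range_iff_exists_fun ℝ).1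
      (hspan (Submodule.subset_span ⟨i, rfl⟩))
    refine ⟨fun r => (fun i => a i r, b r, c r), ?_⟩
    funext i j k
    have hentry := congrArg (fun y : SliceSpace J K => y (j, k)) (ha i)
    simpa [outer, hbc, mul_assoc] using hentry

theorem exists_isBestRankApprox_of_forall_sqDistSum_le {Z : ThreeWayArray I J K}
    {W : Submodule ℝ (SliceSpace J K)} (hW : SpanRankLE R W)
    (hmin : ∀ W' : Submodule ℝ (SliceSpace J K), Module.finrank ℝ W' ≤ R →
      sqDistSum (fun i => sliceEquiv J K (Z i)) W ≤ sqDistSum (fun i => sliceEquiv J K (Z i)) W') :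
    ∃ X, IsBestRankApprox R Z X := by
  let X : ThreeWayArray I J K := fun i =>
    (sliceEquiv J K).symm (W.starProjection (sliceEquiv J K (Z i)))
  have hX (i : Fin I) : sliceEquiv J K (X i) = W.starProjection (sliceEquiv J K (Z i)) :=
    (sliceEquiv J K).apply_symm_apply _
  refine ⟨X, mem_rankAtMost_iff_spanRankLE.2 (hW.mono (Submodule.span_le.2 ?_)), fun Y hY => ?_⟩
  · rintro _ ⟨i, rfl⟩
    simp only [hX, SetLike.mem_coe, Submodule.starProjection_apply_mem]
  · let U := Submodule.span ℝ (Set.range fun i => sliceEquiv J K (Y i))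
    calc frobeniusNorm (Z - X) ^ 2 = sqDistSum (fun i => sliceEquiv J K (Z i)) W := by
          simp only [frobeniusNorm_sq, Pi.sub_apply, map_sub, hX, sqDistSum]
      _ ≤ sqDistSum (fun i => sliceEquiv J K (Z i)) U :=
          hmin U (mem_rankAtMost_iff_spanRankLE.1 hY).finrank_le
      _ ≤ ∑ i, ‖sliceEquiv J K (Z i) - sliceEquiv J K (Y i)‖ ^ 2 :=
          sqDistSum_le fun i => Submodule.subset_span ⟨i, rfl⟩
      _ = frobeniusNorm (Z - Y) ^ 2 := by simp only [frobeniusNorm_sq, Pi.sub_apply, map_sub]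

section Pencil

open Matrix

/-- For a tuple `B` of `J × 2` matrices with columns `B₀` and `B₁`, the matrix `B₁ - t B₀` of its
pencil at `t`: the row vectors annihilating it are the combinations of `B` of the form
`b ⊗ (1, t)`. -/
def pencil (B : Fin R → SliceSpace J 2) (t : ℝ) : Matrix (Fin R) (Fin J) ℝ :=
  Matrix.of fun r j => B r (j, 1) - t * B r (j, 0)

/-- The coefficient matrix whose row `r` is a left null vector of the pencil of `B` at `t r`. -/
def decompositionMatrix (t : Fin R → ℝ) (B : Fin R → SliceSpace J 2) : Matrix (Fin R) (Fin R) ℝ :=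
  Matrix.of fun r => leftKernelVec (pencil B (t r)) (Pi.single r 1)

theorem isDecomposable_sum_smul_of_vecMul_pencil_eq_zero {B : Fin R → SliceSpace J 2} {t : ℝ}
    {c : Fin R → ℝ} (hc : c ᵥ* pencil B t = 0) : IsDecomposable (∑ i, c i • B i) := by
  have hcol (j : Fin J) : ∑ i, c i * B i (j, 1) = t * ∑ i, c i * B i (j, 0) := by
    have hj : ∑ i, c i * (B i (j, 1) - t * B i (j, 0)) = 0 := congrFun hc j
    simp only [mul_sub, Finset.sum_sub_distrib, sub_eq_zero, mul_left_comm _ t] at hj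
    rw [hj, Finset.mul_sum]
  refine ⟨fun j => ∑ i, c i * B i (j, 0), ![1, t], fun j k => ?_⟩
  fin_cases k
  · simp
  · simpa [mul_comm _ t] using hcol j

theorem spanRankLE_span_of_det_ne_zero {t : Fin R → ℝ} {B : Fin R → SliceSpace J 2}
    (h : (decompositionMatrix t B).det ≠ 0) :
    SpanRankLE R (Submodule.span ℝ (Set.range B)) := by
  refine ⟨fun r => ∑ i, decompositionMatrix t B r i • B i,
    fun r => isDecomposable_sum_smul_of_vecMul_pencil_eq_zero (leftKernelVec_vecMul _ _),
    Submodule.span_le.2 ?_⟩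
  rintro _ ⟨l, rfl⟩
  have hinv := nonsing_inv_mul (decompositionMatrix t B) (isUnit_iff_ne_zero.2 h)
  refine (Submodule.mem_span_range_iff_exists_fun ℝ).2 ⟨(decompositionMatrix t B)⁻¹ l, ?_⟩
  simp only [Finset.smul_sum, smul_smul]
  rw [Finset.sum_comm]
  simp only [← Finset.sum_smul, ← mul_apply, hinv, one_apply, ite_smul, one_smul, zero_smul,
    Finset.sum_ite_eq, Finset.mem_univ, if_true]

theorem contDiff_det_decompositionMatrix {k : WithTop ℕ∞} (t : Fin R → ℝ) :
    ContDiff ℝ k fun B : Fin R → SliceSpace J 2 => (decompositionMatrix t B).det := by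
  refine contDiff_det fun r i => contDiff_leftKernelVec_apply (fun a b => ?_) _ _
  simp only [pencil, of_apply]
  fun_prop

/-- The decomposable vectors `(1, t², t⁴, …) ⊗ (1, t)`, whose entries are the powers of `t = t r`
up to the exponent `2 J - 1`. -/
noncomputable def vandermondeSlices (J : ℕ) (t : Fin R → ℝ) (r : Fin R) : SliceSpace J 2 :=
  sliceEquiv J 2 fun j k => t r ^ (2 * (j : ℕ) + (k : ℕ))

theorem linearIndependent_vandermondeSlices (hR : R ≤ 2 * J) {t : Fin R → ℝ}
    (ht : Function.Injective t) : LinearIndependent ℝ (vandermondeSlices J t) := by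
  rw [Fintype.linearIndependent_iff]
  intro g hg
  refine congrFun (eq_zero_of_forall_pow_sum_mul_pow_eq_zero ht fun l => ?_)
  have hl := congrArg (fun y : SliceSpace J 2 =>
    y (⟨(l : ℕ) / 2, by omega⟩, ⟨(l : ℕ) % 2, by omega⟩)) hg
  simpa [vandermondeSlices, Nat.div_add_mod] using hl

theorem pencil_vandermondeSlices_apply (t : Fin R → ℝ) (s : ℝ) (r : Fin R) (j : Fin J) :
    pencil (vandermondeSlices J t) s r j = (t r - s) * (t r ^ 2) ^ (j : ℕ) := by
  simp only [pencil, vandermondeSlices, of_apply, sliceEquiv_apply, Fin.val_zero, Fin.val_one]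
  ring

theorem mulVec_pencil_vandermondeSlices_injective (hJR : J < R) {t : Fin R → ℝ}
    (ht : Function.Injective (t ^ 2)) (r : Fin R) :
    Function.Injective (pencil (vandermondeSlices J t) (t r)).mulVec := by
  refine (injective_iff_map_eq_zero (mulVecLin _)).2 fun x hx => ?_
  obtain ⟨f⟩ : Nonempty (Fin J ↪ {i // i ≠ r}) :=
    Function.Embedding.nonempty_of_card_le (by simpa using Nat.le_pred_of_lt hJR)
  refine eq_zero_of_forall_index_sum_pow_mul_eq_zero
    (ht.comp (Subtype.val_injective.comp f.injective)) fun i => ?_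
  have hrow : (t (f i) - t r) * ∑ j : Fin J, (t (f i) ^ 2) ^ (j : ℕ) * x j = 0 := by
    simpa only [mulVecLin_apply, mulVec, dotProduct, pencil_vandermondeSlices_apply, mul_assoc,
      ← Finset.mul_sum, Pi.zero_apply] using congrFun hx (f i)
  refine (mul_eq_zero.1 hrow).resolve_left (sub_ne_zero.2 fun h => (f i).2 (ht ?_))
  simp only [Pi.pow_apply, h]

theorem det_decompositionMatrix_vandermondeSlices_ne_zero (hJR : J < R) {t : Fin R → ℝ}
    (ht : Function.Injective (t ^ 2)) :
    (decompositionMatrix t (vandermondeSlices J t)).det ≠ 0 := by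
  have hdiag : decompositionMatrix t (vandermondeSlices J t) = diagonal fun r =>
      ((pencil (vandermondeSlices J t) (t r))ᵀ * pencil (vandermondeSlices J t) (t r)).det := by
    ext r i
    have hrow : Pi.single r 1 ᵥ* pencil (vandermondeSlices J t) (t r) = 0 := by
      ext j
      simp [pencil_vandermondeSlices_apply]
    rw [decompositionMatrix, of_apply, leftKernelVec_of_vecMul_eq_zero hrow]
    simp [diagonal_apply, Pi.single_apply, eq_comm]
  rw [hdiag, det_diagonal]
  exact Finset.prod_ne_zero_iff.2 fun r _ =>
    det_transpose_mul_self_ne_zero (mulVec_pencil_vandermondeSlices_injective hJR ht r)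

end Pencil

open Module

theorem ae_spanRankLE_map_reflectionProd (hJR : J < R) (hR : R ≤ 2 * J)
    {W : Submodule ℝ (SliceSpace J 2)} (hW : finrank ℝ W = R) :
    ∀ᵐ v : Fin (finrank ℝ (SliceSpace J 2)) → SliceSpace J 2,
      SpanRankLE R (W.map (reflectionProd v).toLinearEquiv.toLinearMap) := by
  let t : Fin R → ℝ := fun r => r
  have ht : Function.Injective t := Nat.cast_injective.comp Fin.val_injective
  have htsq : Function.Injective (t ^ 2) := fun r s h =>
    ht ((pow_left_inj₀ r.val.cast_nonneg s.val.cast_nonneg two_ne_zero).1 h)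
  filter_upwards [ae_exists_span_range_eq_map_reflectionProd (Nat.ne_zero_of_lt hJR)
    (contDiff_det_decompositionMatrix t) (linearIndependent_vandermondeSlices hR ht)
    (det_decompositionMatrix_vandermondeSlices_ne_zero hJR htsq) hW] with v ⟨B, hB, hspan⟩
  exact hspan ▸ spanRankLE_span_of_det_ne_zero hB

/-- A linear isometry of the slice space applied to all horizontal slices of an array. -/
noncomputable def mapSlices (φ : SliceSpace J K ≃ₗᵢ[ℝ] SliceSpace J K) :
    ThreeWayArray I J K ≃ₗ[ℝ] ThreeWayArray I J K :=
  LinearEquiv.piCongrRight fun _ => sliceEquiv J K ≪≫ₗ φ.toLinearEquiv ≪≫ₗ (sliceEquiv J K).symm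

theorem mapSlices_apply (φ : SliceSpace J K ≃ₗᵢ[ℝ] SliceSpace J K) (Z : ThreeWayArray I J K)
    (i : Fin I) : mapSlices φ Z i = (sliceEquiv J K).symm (φ (sliceEquiv J K (Z i))) :=
  rfl

theorem sliceEquiv_mapSlices (φ : SliceSpace J K ≃ₗᵢ[ℝ] SliceSpace J K) (Z : ThreeWayArray I J K)
    (i : Fin I) : sliceEquiv J K (mapSlices φ Z i) = φ (sliceEquiv J K (Z i)) := by
  rw [mapSlices_apply, LinearEquiv.apply_symm_apply]

theorem ae_exists_isBestRankApprox_mapSlices (hJR : J < R) (hR : R ≤ 2 * J)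
    (Z : ThreeWayArray I J 2) :
    ∀ᵐ v : Fin (finrank ℝ (SliceSpace J 2)) → SliceSpace J 2,
      ∃ X, IsBestRankApprox R (mapSlices (reflectionProd v) Z) X := by
  let z : Fin I → SliceSpace J 2 := fun i => sliceEquiv J 2 (Z i)
  have hRdim : R ≤ finrank ℝ (SliceSpace J 2) := by simpa [mul_comm J] using hR
  obtain ⟨W, hW, hmin⟩ := exists_sqDistSum_le (𝕜 := ℝ) z hRdim
  filter_upwards [ae_spanRankLE_map_reflectionProd hJR hR hW] with v hv
  let φ := reflectionProd v
  refine exists_isBestRankApprox_of_forall_sqDistSum_le hv fun U hU => ?_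
  simp only [sliceEquiv_mapSlices]
  let U' := U.map φ.symm.toLinearEquiv.toLinearMap
  have hU' : U'.map φ.toLinearEquiv.toLinearMap = U := by
    have hid : φ.toLinearEquiv.toLinearMap ∘ₗ φ.symm.toLinearEquiv.toLinearMap = LinearMap.id :=
      LinearMap.ext φ.apply_symm_apply
    rw [← Submodule.map_comp, hid, Submodule.map_id]
  calc sqDistSum (φ ∘ z) (W.map φ.toLinearEquiv.toLinearMap)
      = sqDistSum z W := sqDistSum_map φ z W
    _ ≤ sqDistSum z U' := hmin U' ((Submodule.finrank_map_le _ U).trans hU)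
    _ = sqDistSum (φ ∘ z) (U'.map φ.toLinearEquiv.toLinearMap) :=
        (sqDistSum_map φ z U').symm
    _ = sqDistSum (φ ∘ z) U := by simp only [hU']

theorem measurable_mapSlices_reflectionProd {n : ℕ} :
    Measurable fun p : (Fin n → SliceSpace J K) × ThreeWayArray I J K =>
      mapSlices (reflectionProd p.1) p.2 := by
  have hequiv : Measurable (sliceEquiv J K) :=
    (sliceEquiv J K).toLinearMap.continuous_of_finiteDimensional.measurable
  have hsymm : Measurable (sliceEquiv J K).symm :=
    (sliceEquiv J K).symm.toLinearMap.continuous_of_finiteDimensional.measurable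
  refine measurable_pi_lambda _ fun i => ?_
  simp only [mapSlices_apply]
  exact hsymm.comp (measurable_reflectionProd measurable_fst
    (hequiv.comp ((measurable_pi_apply i).comp measurable_snd)))

instance isAddHaarMeasure_volume :
    (volume : Measure (ThreeWayArray I J K)).IsAddHaarMeasure :=
  haveI : (volume : Measure (Fin J → Fin K → ℝ)).IsAddHaarMeasure :=
    Measure.pi.isAddHaarMeasure fun _ => volume
  Measure.pi.isAddHaarMeasure fun _ => volume

theorem ae_of_ae_mapSlices (φ : SliceSpace J K ≃ₗᵢ[ℝ] SliceSpace J K)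
    {p : ThreeWayArray I J K → Prop} (h : ∀ᵐ Z : ThreeWayArray I J K, p (mapSlices φ Z)) :
    ∀ᵐ Z : ThreeWayArray I J K, p Z := by
  have hpreserving := Measure.LinearMap.quasiMeasurePreserving
    (volume : Measure (ThreeWayArray I J K))
    (mapSlices φ).symm.toLinearMap (LinearEquiv.isUnit_det' _).ne_zero
  filter_upwards [hpreserving.ae h] with Z hZ
  simpa only [LinearEquiv.coe_coe, LinearEquiv.apply_symm_apply] using hZ

end ThreeWayArray

open ThreeWayArray in
theorem corollary4p2_general (I J R : ℕ) (hRJ : J < R) :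
    ∀ᵐ Z : ThreeWayArray I J 2, ∃ X, IsBestRankApprox R Z X := by
  rcases le_total (J * 2) R with hR | hR
  · refine .of_forall fun Z => ⟨Z, isBestRankApprox_self ?_⟩
    rw [rankAtMost_eq_univ hR]
    trivial
  have hmeas : MeasurableSet {p : (Fin (Module.finrank ℝ (SliceSpace J 2)) → SliceSpace J 2) ×
      ThreeWayArray I J 2 | ∃ X, IsBestRankApprox R (mapSlices (reflectionProd p.1) p.2) X} :=
    measurable_mapSlices_reflectionProd (measurableSet_setOf_exists_isBestRankApprox I J 2 R)
  have hswap : ∀ᵐ v : Fin (Module.finrank ℝ (SliceSpace J 2)) → SliceSpace J 2,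
      ∀ᵐ Z : ThreeWayArray I J 2, ∃ X, IsBestRankApprox R (mapSlices (reflectionProd v) Z) X :=
    (Measure.ae_ae_comm hmeas).2
      (.of_forall (ae_exists_isBestRankApprox_mapSlices hRJ (by omega)))
  obtain ⟨v, hv⟩ := hswap.exists
  exact ae_of_ae_mapSlices _ hv

theorem corollary4p2 (I J R : ℕ) (hJ : 2 ≤ J) (hIJ : J < I) (hRJ : J < R)
    (hR : R < min I (2 * J)) :
    ∀ᵐ Z : ThreeWayArray I J 2 ∂volume,
      ∃ X : ThreeWayArray I J 2, ThreeWayArray.IsBestRankApprox R Z X :=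
  corollary4p2_general I J R hRJ
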